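/- Let $d\ge 1$. For a symmetric Lévy measure $\nu$ on $\mathbb R^d$ (that is, $\nu(\{0\})=0$, $\int(1\wedge|y|^2)\,\nu(dy)<\infty$ and $\nu(-D)=\nu(D)$ for Borel $D$) with $\nu(\mathbb R^d)=\infty$, put $$\Phi(\xi)=\int_{\mathbb R^d}(1-\cos\langle\xi,y\rangle)\,\nu(dy),\qquad \Psi(r)=\sup_{|\xi|\le r}\Phi(\xi),\qquad \Psi^{-1}(s)=\sup\{r>0:\Psi(r)=s\},\qquad h(t)=\frac1{\Psi^{-1}(1/t)},$$ and let $(P_t)_{t\ge0}$ be the convolution semigroup of probability measures with Fourier transform $\int e^{i\langle\xi,y\rangle}P_t(dy)=e^{-t\Phi(\xi)}$. Condition (A1), with constants $M_0>0$ and $t_p\in(0,\infty]$, says that $$\int_{\mathbb R^d}e^{-t\Phi(\xi)}|\xi|\,d\xi\le M_0\,h(t)^{-d-1},\qquad t\in(0,t_p).$$ There are positive constants $\kappa_1=\kappa_1(d)$ and $\kappa_2,\theta,c_1,c_2$ depending only on $d$ and $M_0$ such that, for all $\nu$ and $t_p$ as above for which (A1) holds with $M_0$ and $t_p$, each $P_t$,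 $t>0$, has a continuous density $p_t$ with respect to Lebesgue measure, $$\kappa_1h(t)^{-d}\le p_t(x)\le\kappa_2h(t)^{-d}\qquad\text{for } t\in(0,t_p),\ |x|<\theta h(t),$$ and for every $\eta\in(0,\theta)$ the following hold. (a) If $F:[0,\infty)\to[0,\infty)$ is strictly increasing and continuous, $F(0)=0$, $\lim_{s\to\infty}F(s)=\infty$ and $F(s)\le\Psi(s)/s$ for all $s>0$, then $$p_t(x)\ge c_1h(t)^{-d}\exp\!\left(-\frac{c_2|x|}{\eta}\,F^{-1}\!\left(\frac{2|x|}{\eta t}\right)\right)\qquad\text{for all } t\in(0,t_p),\ x\in\mathbb R^d.$$ (b) If $s_0\in(0,\infty)$ and $F:[0,s_0]\to[0,\infty)$ is strictly increasing and continuous, $F(0)=0$ and $F(s)\le\Psi(s)/s$ for $0<s\le s_0$, then the same lower bound holds for all $t\in\left(\frac1{s_0F(s_0/2)},t_p\right)$ and all $x$ with $|x|<\frac{\eta tF(s_0/2)}2$. -/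

import Mathlib

open MeasureTheory Filter Topology

noncomputable section

namespace LevyHeat

/-- A symmetric Lévy measure on `ℝ^d` of infinite total mass. -/
structure IsSymmInfLevyMeasure {d : ℕ} (ν : Measure (EuclideanSpace ℝ (Fin d))) : Prop where
  zero_mass : ν {0} = 0
  lintegral_lt_top : ∫⁻ y, ENNReal.ofReal (min 1 (‖y‖ ^ 2)) ∂ν < ⊤
  symm : ∀ D : Set (EuclideanSpace ℝ (Fin d)), MeasurableSet D → ν ((fun y => -y) ⁻¹' D) = ν D
  infinite_mass : ν Set.univ = ⊤

/-- The characteristic exponent `Φ(ξ) = ∫ (1 - cos ⟨ξ, y⟩) ν(dy)`. -/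
def Phi {d : ℕ} (ν : Measure (EuclideanSpace ℝ (Fin d))) (ξ : EuclideanSpace ℝ (Fin d)) : ℝ :=
  ∫ y, (1 - Real.cos (inner ℝ ξ y)) ∂ν

/-- `Ψ(r) = sup_{|ξ| ≤ r} Φ(ξ)`. -/
def Psi {d : ℕ} (ν : Measure (EuclideanSpace ℝ (Fin d))) (r : ℝ) : ℝ :=
  sSup (Phi ν '' {ξ | ‖ξ‖ ≤ r})

/-- `Ψ⁻¹(s) = sup {r > 0 : Ψ(r) = s}`. -/
def PsiInv {d : ℕ} (ν : Measure (EuclideanSpace ℝ (Fin d))) (s : ℝ) : ℝ :=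
  sSup {r | 0 < r ∧ Psi ν r = s}

/-- `h(t) = 1 / Ψ⁻¹(1/t)`. -/
def h {d : ℕ} (ν : Measure (EuclideanSpace ℝ (Fin d))) (t : ℝ) : ℝ :=
  1 / PsiInv ν (1 / t)

/-- Condition (A1) with the constants `M₀ > 0` and `tp ∈ (0, ∞]`:
`∫ e^{-tΦ(ξ)} |ξ| dξ ≤ M₀ h(t)^{-d-1}` for `0 < t < tp`. -/
structure CondA1 {d : ℕ} (ν : Measure (EuclideanSpace ℝ (Fin d))) (M₀ : ℝ) (tp : EReal) :
    Prop where
  M₀_pos : 0 < M₀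
  tp_pos : 0 < tp
  bound : ∀ t : ℝ, 0 < t → (t : EReal) < tp →
    ∫⁻ ξ : EuclideanSpace ℝ (Fin d), ENNReal.ofReal (Real.exp (-(t * Phi ν ξ)) * ‖ξ‖)
      ≤ ENNReal.ofReal (M₀ * h ν t ^ (-(d : ℤ) - 1))

/-- `(P t)_{t ≥ 0}` is the family of probability measures with Fourier transforms
`exp(-tΦ)`. These transforms determine each `P t` uniquely and make the family a
convolution semigroup. -/
structure IsLevySemigroup {d : ℕ} (ν : Measure (EuclideanSpace ℝ (Fin d)))
    (P : ℝ → Measure (EuclideanSpace ℝ (Fin d))) : Prop where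
  isProbabilityMeasure : ∀ t : ℝ, 0 ≤ t → IsProbabilityMeasure (P t)
  charFun_eq : ∀ t : ℝ, 0 ≤ t → ∀ ξ : EuclideanSpace ℝ (Fin d),
    charFun (P t) ξ = ((Real.exp (-(t * Phi ν ξ)) : ℝ) : ℂ)

/-- `f` is the (necessarily unique) continuous density of `μ` with respect to Lebesgue measure. -/
structure IsContinuousDensity {d : ℕ} (μ : Measure (EuclideanSpace ℝ (Fin d)))
    (f : EuclideanSpace ℝ (Fin d) → ℝ) : Prop where
  continuous : Continuous f
  nonneg : ∀ x, 0 ≤ f x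
  eq_withDensity : μ = volume.withDensity (fun x => ENNReal.ofReal (f x))

end LevyHeat

end

/-! Fourier inversion gives `p_t(x) = (2π)^{-d} ∫ cos⟨ξ,x⟩ e^{-tΦ(ξ)} dξ`. By definition of `h`, `tΦ
≤ 1` on the ball `|ξ| ≤ 1/h(t)`, so `∫ e^{-tΦ}` is at least `e^{-1} ω h(t)^{-d}`, with `ω` the
volume of the unit ball. Off that ball `1 ≤ h(t)|ξ|`, so (A1) bounds the same integral above by `(ω
+ M₀) h(t)^{-d}`. Replacing the cosine by `1` costs at most `|x| ∫ e^{-tΦ}|ξ| dξ`, which (A1) makes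
at most half of the lower bound when `|x| ≤ θ h(t)`. These are the near-diagonal estimates
(`CondA1.heatKernel_le`, `CondA1.le_heatKernel`).

Far from the origin one chains: cut `t` into `n` equal times and go to `x` along the points
`(k/n)x`. If `|x|/n < θ h(t/n)/2`, each convolution contributes a factor `q` depending only on `d`
and `M₀`, because the height `h^{-d}` of the density cancels the volume `h^d` of the ball integrated
over. Hence `p_t(x) ≥ κ₁ h(t)^{-d} q^{n-1}` (`IsLevySemigroup.le_density_of_steps`).

The function `F` bounds the required `n`. Let `F(s) = 2|x|/(ηt)` and `n > 2|x|s/η`. Then `r =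
ηn/(2|x|)` exceeds `s`, so `Ψ(r) ≥ r F(r) > r F(s) = n/t`, whence `h(t/n) > 1/r`, which is the step
condition (`div_lt_h_of_speed`). Taking `n - 1 = ⌊2|x|s/η⌋` turns `q^{n-1}` into the stated
exponential. -/

namespace LevyHeat

/-! ### Fourier inversion for probability measures -/

section Inversion

open scoped FourierTransform ContDiff

variable {E : Type*} [NormedAddCommGroup E] [InnerProductSpace ℝ E] [FiniteDimensional ℝ E]
  [MeasurableSpace E] [BorelSpace E]

/-- Two locally finite measures which agree on smooth compactly supported functions are equal. -/
theorem measure_ext_of_integral_contDiff {μ ν : Measure E} [IsLocallyFiniteMeasure μ]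
    [IsLocallyFiniteMeasure ν]
    (H : ∀ g : E → ℝ, ContDiff ℝ ∞ g → HasCompactSupport g → ∫ x, g x ∂μ = ∫ x, g x ∂ν) :
    μ = ν := by
  -- One inequality on open sets suffices by symmetry. A smooth bump between a compact `K ⊆ U` and
  -- `U` gives `μ K ≤ ν U`, and inner regularity passes from `K` to `U`.
  have key : ∀ (μ ν : Measure E) [IsLocallyFiniteMeasure μ] [IsLocallyFiniteMeasure ν],
      (∀ g : E → ℝ, ContDiff ℝ ∞ g → HasCompactSupport g → ∫ x, g x ∂μ = ∫ x, g x ∂ν) →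
      ∀ U : Set E, IsOpen U → μ U ≤ ν U := by
    intro μ ν _ _ H U hU
    rw [hU.measure_eq_iSup_isCompact]
    refine iSup₂_le fun K hKU => iSup_le fun hK => ?_
    obtain ⟨V, hV, hKV, hVU, hVc⟩ := exists_open_between_and_isCompact_closure hK hU hKU
    obtain ⟨g, hg, hgr, hgs, hg1⟩ := exists_contMDiff_support_eq_eq_one_iff (n := (⊤ : ℕ∞))
      (modelWithCornersSelf ℝ E) hV hK.isClosed hKV
    have hg := hg.contDiff
    have h0 : ∀ x, 0 ≤ g x := fun x => (hgr (Set.mem_range_self x)).1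
    have h1 : ∀ x, g x ≤ 1 := fun x => (hgr (Set.mem_range_self x)).2
    have hcs : HasCompactSupport g := by
      unfold HasCompactSupport tsupport
      rwa [hgs]
    have hμ : Integrable g μ := hg.continuous.integrable_of_hasCompactSupport hcs
    have hν : Integrable g ν := hg.continuous.integrable_of_hasCompactSupport hcs
    calc μ K = ∫⁻ x, K.indicator 1 x ∂μ := by
          rw [lintegral_indicator_one hK.measurableSet]
      _ ≤ ∫⁻ x, ENNReal.ofReal (g x) ∂μ := by
          refine lintegral_mono fun x => ?_
          by_cases hx : x ∈ K
          · simp [hx, (hg1 x).1 hx]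
          · simp [hx]
      _ = ∫⁻ x, ENNReal.ofReal (g x) ∂ν := by
          rw [← ofReal_integral_eq_lintegral_ofReal hμ (ae_of_all _ h0), H g hg hcs,
            ofReal_integral_eq_lintegral_ofReal hν (ae_of_all _ h0)]
      _ ≤ ∫⁻ x, U.indicator 1 x ∂ν := by
          refine lintegral_mono fun x => ?_
          by_cases hx : x ∈ U
          · simpa [hx] using h1 x
          · have : x ∉ Function.support g := fun h => hx (hVU (subset_closure (hgs ▸ h)))
            simp [Function.notMem_support.1 this]
      _ = ν U := by rw [lintegral_indicator_one hU.measurableSet]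
  exact Measure.OuterRegular.ext_isOpen fun U hU =>
    le_antisymm (key μ ν H U hU) (key ν μ (fun g hg hc => (H g hg hc).symm) U hU)

/-- A continuous function whose integrals against nonnegative smooth compactly supported
functions are nonnegative is nonnegative. -/
theorem nonneg_of_integral_contDiff_mul_nonneg {f : E → ℝ} (hf : Continuous f)
    (H : ∀ g : E → ℝ, ContDiff ℝ ∞ g → HasCompactSupport g → (∀ x, 0 ≤ g x) →
      0 ≤ ∫ x, g x * f x) (x : E) : 0 ≤ f x := by
  by_contra! hx
  obtain ⟨g, hgs, hgc, hg, hgr, hgx⟩ := exists_contDiff_tsupport_subset (n := ⊤)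
    ((isOpen_Iio.preimage hf).mem_nhds (show x ∈ f ⁻¹' Set.Iio 0 from hx))
  have h0 : ∀ x, 0 ≤ g x := fun x => (hgr (Set.mem_range_self x)).1
  have hneg : ∀ y, 0 ≤ -(g y * f y) := fun y => by
    by_cases hy : y ∈ tsupport g
    · have : f y < 0 := hgs hy
      nlinarith [h0 y]
    · simp [image_eq_zero_of_notMem_tsupport hy]
  have hpos : 0 < ∫ y, -(g y * f y) := by
    refine Continuous.integral_pos_of_hasCompactSupport_nonneg_nonzero (x := x)
      (by have := hg.continuous; fun_prop) ?_ hneg (by simp [hgx, hx.ne])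
    exact (hgc.mul_right).neg
  rw [integral_neg] at hpos
  linarith [H g hg hgc h0]

/-- The inverse Fourier transform of an even real function, in the probabilist's normalization. -/
noncomputable def cosTransform (φ : E → ℝ) (x : E) : ℝ :=
  ((2 * Real.pi) ^ Module.finrank ℝ E)⁻¹ * ∫ ξ, Real.cos (inner ℝ ξ x) * φ ξ

theorem integrable_cos_mul {φ : E → ℝ} (hφ : Integrable φ) (x : E) :
    Integrable fun ξ => Real.cos (inner ℝ ξ x) * φ ξ :=
  hφ.bdd_mul (c := 1) (by fun_prop) (ae_of_all _ fun ξ => by simpa using Real.abs_cos_le_one _)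

theorem continuous_cosTransform {φ : E → ℝ} (hφ : Integrable φ) :
    Continuous (cosTransform φ) := by
  refine continuous_const.mul ?_
  refine continuous_of_dominated (bound := fun ξ => ‖φ ξ‖)
    (fun x => (integrable_cos_mul hφ x).aestronglyMeasurable) (fun x => ae_of_all _ fun ξ => ?_)
    hφ.norm (ae_of_all _ fun ξ => by fun_prop)
  rw [norm_mul]
  exact mul_le_of_le_one_left (norm_nonneg _) (by simpa using Real.abs_cos_le_one _)

/-- Fourier duality used twice. With `g = 𝓕 k` and `k` Schwartz, the first use turns `∫ g dμ` into
the integral of `k` against the rescaled characteristic function; the second moves the inverse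
transform in `k` from `g` onto `φ`. -/
theorem integral_eq_integral_mul_cosTransform {μ : Measure E} [IsProbabilityMeasure μ] {φ : E → ℝ}
    (hφ : Integrable φ) (hμ : ∀ ξ, charFun μ ξ = (φ ξ : ℂ)) {g : E → ℝ} (hg : ContDiff ℝ ∞ g)
    (hgc : HasCompactSupport g) : ∫ x, g x ∂μ = ∫ x, g x * cosTransform φ x := by
  have hpi : (2 * Real.pi) ≠ 0 := by positivity
  let G : SchwartzMap E ℂ := HasCompactSupport.toSchwartzMap (f := fun x => (g x : ℂ))
    (hgc.comp_left (g := fun y : ℝ => (y : ℂ)) (by simp)) (Complex.ofRealCLM.contDiff.comp hg)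
  have hG : ∀ x, G x = (g x : ℂ) := fun x => rfl
  let k : SchwartzMap E ℂ := 𝓕⁻ G
  have hk : 𝓕 k = G := FourierTransform.fourier_fourierInv_eq G
  -- The rescaling by `-2π` converts between the kernel `e^{i⟨ξ,x⟩}` of `charFun` and Mathlib's
  -- `e^{-2πi⟨v,x⟩}`; its Jacobian yields the factor `(2π)^{-d}`.
  let ψ : E → ℂ := fun v => (φ (-((2 * Real.pi) • v)) : ℂ)
  have hψ : Integrable ψ := by
    have h1 := (hφ.comp_smul (R := -(2 * Real.pi)) (by simp)).ofReal (𝕜 := ℂ)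
    simp only [neg_smul] at h1
    exact h1
  have hL : Continuous fun p : E × E => innerₗ E p.1 p.2 := by
    simpa using (continuous_inner (𝕜 := ℝ) (E := E))
  have hL' : Continuous fun p : E × E => (-innerₗ E) p.1 p.2 := by
    exact (continuous_inner (𝕜 := ℝ) (E := E)).neg
  have hflip : (-innerₗ E).flip = -innerₗ E := by
    ext v w
    simp [real_inner_comm]
  have e1 : ∫ x, G x ∂μ = ∫ v, k v * ψ v := by
    have := VectorFourier.integral_fourierIntegral_smul_eq_flip (μ := (volume : Measure E))
      (ν := μ) (L := innerₗ E) (e := Real.fourierChar) (f := k) (g := fun _ => (1 : ℂ))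
      Real.continuous_fourierChar hL k.integrable (integrable_const _)
    simp only [smul_eq_mul, mul_one] at this
    rw [← hk]
    refine Eq.trans ?_ (this.trans ?_)
    · rfl
    · refine integral_congr_ae (ae_of_all _ fun v => ?_)
      dsimp only
      congr 1
      simp only [ψ]
      rw [← hμ, charFun_eq_fourierIntegral', smul_neg, smul_smul]
      rw [flip_innerₗ, neg_mul, inv_mul_cancel₀ hpi]
      simp
      rfl
  have e2 : ∫ v, k v * ψ v = ∫ x, G x * VectorFourier.fourierIntegral Real.fourierChar
      (volume : Measure E) (-innerₗ E) ψ x := by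
    have := VectorFourier.integral_fourierIntegral_smul_eq_flip (μ := (volume : Measure E))
      (ν := (volume : Measure E)) (L := -innerₗ E) (e := Real.fourierChar) (f := G) (g := ψ)
      Real.continuous_fourierChar hL' G.integrable hψ
    simp only [smul_eq_mul] at this
    rw [hflip] at this
    rw [← this]
    refine integral_congr_ae (ae_of_all _ fun v => ?_)
    dsimp only [k]
    rw [SchwartzMap.fourierInv_coe]
    rfl
  -- Only the real part is computed: `∫ g dμ` and `g` are real, so the imaginary part drops out and
  -- evenness of `φ` is never needed.
  have e3 : ∀ x, (VectorFourier.fourierIntegral Real.fourierChar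
      (volume : Measure E) (-innerₗ E) ψ x).re = cosTransform φ x := by
    intro x
    have h1 := VectorFourier.fourierIntegral_convergent_iff (μ := (volume : Measure E))
      Real.continuous_fourierChar hL' (f := ψ) x
    have h2 : cosTransform φ x = ∫ v, (fun ξ => Real.cos (inner ℝ ξ x) * φ ξ)
        (-(2 * Real.pi) • v) := by
      rw [Measure.integral_comp_smul volume (fun ξ => Real.cos (inner ℝ ξ x) * φ ξ), cosTransform,
        abs_inv, abs_pow, abs_neg,
        abs_of_pos (by positivity), smul_eq_mul]
    rw [h2, VectorFourier.fourierIntegral]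
    have h3 := integral_re (𝕜 := ℂ) (h1.2 hψ)
    simp only [RCLike.re_eq_complex_re] at h3
    rw [← h3]
    refine integral_congr_ae (ae_of_all _ fun v => ?_)
    simp only [ψ, LinearMap.neg_apply, innerₗ_apply_apply, neg_neg, neg_smul, Circle.smul_def,
      Real.fourierChar_apply, smul_eq_mul, Complex.re_mul_ofReal, inner_neg_left, Real.cos_neg,
      inner_smul_left]
    rw [Complex.exp_ofReal_mul_I_re]
    simp
  have e4 : ((∫ x, g x ∂μ : ℝ) : ℂ) = ∫ x, G x * VectorFourier.fourierIntegral Real.fourierChar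
      (volume : Measure E) (-innerₗ E) ψ x := by
    rw [← e2, ← e1, ← integral_complex_ofReal]
    rfl
  have hint : Integrable fun x => G x * VectorFourier.fourierIntegral Real.fourierChar
      (volume : Measure E) (-innerₗ E) ψ x := by
    refine G.integrable.mul_bdd (c := ∫ v, ‖ψ v‖)
      (VectorFourier.fourierIntegral_continuous Real.continuous_fourierChar hL'
        hψ).aestronglyMeasurable (ae_of_all _ fun x => ?_)
    exact VectorFourier.norm_fourierIntegral_le_integral_norm _ _ _ _ _
  have e5 := congrArg Complex.re e4
  have h3 := integral_re (𝕜 := ℂ) hint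
  simp only [RCLike.re_eq_complex_re] at h3
  rw [Complex.ofReal_re, ← h3] at e5
  rw [e5]
  refine integral_congr_ae (ae_of_all _ fun x => ?_)
  dsimp only
  rw [hG, Complex.re_ofReal_mul, e3]

theorem cosTransform_nonneg {μ : Measure E} [IsProbabilityMeasure μ] {φ : E → ℝ}
    (hφ : Integrable φ) (hμ : ∀ ξ, charFun μ ξ = (φ ξ : ℂ)) (x : E) : 0 ≤ cosTransform φ x := by
  refine nonneg_of_integral_contDiff_mul_nonneg (continuous_cosTransform hφ)
    (fun g hg hgc h0 => ?_) x
  rw [← integral_eq_integral_mul_cosTransform hφ hμ hg hgc]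
  exact integral_nonneg h0

/-- Fourier inversion for probability measures with integrable real characteristic function. -/
theorem eq_withDensity_cosTransform {μ : Measure E} [IsProbabilityMeasure μ] {φ : E → ℝ}
    (hφ : Integrable φ) (hμ : ∀ ξ, charFun μ ξ = (φ ξ : ℂ)) :
    μ = volume.withDensity fun x => ENNReal.ofReal (cosTransform φ x) := by
  have hc := continuous_cosTransform hφ
  have : IsLocallyFiniteMeasure
      ((volume : Measure E).withDensity fun x => ENNReal.ofReal (cosTransform φ x)) :=
    IsLocallyFiniteMeasure.withDensity_ofReal hc
  refine measure_ext_of_integral_contDiff fun g hg hgc => ?_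
  rw [integral_eq_integral_mul_cosTransform hφ hμ hg hgc,
    integral_withDensity_eq_integral_toReal_smul (by fun_prop) (by simp)]
  refine integral_congr_ae (ae_of_all _ fun x => ?_)
  simp [ENNReal.toReal_ofReal (cosTransform_nonneg hφ hμ x), mul_comm]

end Inversion

/-! ### The exponent `Φ` and its radial supremum `Ψ` -/

variable {d : ℕ} {ν : Measure (EuclideanSpace ℝ (Fin d))}
  {P : ℝ → Measure (EuclideanSpace ℝ (Fin d))} {M₀ : ℝ} {tp : EReal}

theorem Phi_nonneg (ν : Measure (EuclideanSpace ℝ (Fin d))) (ξ : EuclideanSpace ℝ (Fin d)) :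
    0 ≤ Phi ν ξ :=
  integral_nonneg fun _ => sub_nonneg.2 (Real.cos_le_one _)

theorem Phi_zero (ν : Measure (EuclideanSpace ℝ (Fin d))) : Phi ν 0 = 0 := by simp [Phi]

/-- `Φ` is minus the logarithm of the characteristic function of `P 1`, and characteristic functions
are continuous. -/
theorem IsLevySemigroup.continuous_Phi (hP : IsLevySemigroup ν P) : Continuous (Phi ν) := by
  have := hP.isProbabilityMeasure 1 zero_le_one
  have h1 : ∀ ξ, Phi ν ξ = -Real.log (charFun (P 1) ξ).re := fun ξ => by
    rw [hP.charFun_eq 1 zero_le_one ξ, Complex.ofReal_re, Real.log_exp]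
    ring
  rw [funext h1]
  refine (Continuous.log (Complex.continuous_re.comp continuous_charFun) fun ξ => ?_).neg
  rw [Function.comp_apply, hP.charFun_eq 1 zero_le_one ξ, Complex.ofReal_re]
  exact (Real.exp_pos _).ne'

theorem Psi_eq (ν : Measure (EuclideanSpace ℝ (Fin d))) (r : ℝ) :
    Psi ν r = sSup (Phi ν '' Metric.closedBall 0 r) := by
  rw [Psi]
  congr 2
  ext ξ
  simp

theorem Phi_le_Psi (hc : Continuous (Phi ν)) {ξ : EuclideanSpace ℝ (Fin d)} {r : ℝ}
    (hξ : ‖ξ‖ ≤ r) : Phi ν ξ ≤ Psi ν r := by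
  rw [Psi_eq]
  exact le_csSup ((isCompact_closedBall 0 r).image hc).bddAbove
    (Set.mem_image_of_mem _ (by simpa using hξ))

theorem Psi_mono (hc : Continuous (Phi ν)) {r r' : ℝ} (hr : 0 ≤ r) (h : r ≤ r') :
    Psi ν r ≤ Psi ν r' := by
  refine csSup_le ⟨_, Set.mem_image_of_mem _ (show ‖(0 : EuclideanSpace ℝ (Fin d))‖ ≤ r by
    simpa using hr)⟩ ?_
  rintro _ ⟨ξ, hξ, rfl⟩
  exact Phi_le_Psi hc (le_trans hξ h)

theorem Psi_zero (ν : Measure (EuclideanSpace ℝ (Fin d))) : Psi ν 0 = 0 := by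
  simp [Psi, Phi_zero]

-- Rescaling to the unit ball makes the supremum run over a fixed compact set.
theorem continuousOn_Psi (hc : Continuous (Phi ν)) : ContinuousOn (Psi ν) (Set.Ici 0) := by
  have h1 : Continuous fun r : ℝ =>
      sSup ((fun ξ : EuclideanSpace ℝ (Fin d) => Phi ν (r • ξ)) '' Metric.closedBall 0 1) :=
    (isCompact_closedBall (0 : EuclideanSpace ℝ (Fin d)) 1).continuous_sSup
      (f := fun (r : ℝ) ξ => Phi ν (r • ξ)) (by unfold Function.HasUncurry.uncurry; fun_prop)
  refine h1.continuousOn.congr fun r hr => ?_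
  have h2 : Metric.closedBall (0 : EuclideanSpace ℝ (Fin d)) r
      = (fun ξ => r • ξ) '' Metric.closedBall 0 1 := by
    have := smul_unitClosedBall_of_nonneg (E := EuclideanSpace ℝ (Fin d)) (r := r) hr
    rw [← this]
    rfl
  rw [Psi_eq, h2, Set.image_image]

theorem exp_neg_mul_Phi_le_one {t : ℝ} (ht : 0 ≤ t) (ξ : EuclideanSpace ℝ (Fin d)) :
    Real.exp (-(t * Phi ν ξ)) ≤ 1 :=
  Real.exp_le_one_iff.2 (neg_nonpos.2 (mul_nonneg ht (Phi_nonneg ν ξ)))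

theorem CondA1.exists_pos_lt (hA : CondA1 ν M₀ tp) {t : ℝ} (ht : 0 < t) :
    ∃ t₀ : ℝ, 0 < t₀ ∧ t₀ ≤ t ∧ (t₀ : EReal) < tp := by
  obtain ⟨s, hs0, hs⟩ := EReal.lt_iff_exists_real_btwn.1 hA.tp_pos
  exact ⟨min s t, lt_min (by exact_mod_cast hs0) ht, min_le_right _ _,
    lt_of_le_of_lt (by exact_mod_cast min_le_left s t) hs⟩

/-- If `Φ ≤ C`, the integrand in (A1) is at least `e^{-tC}` outside the unit ball, a set of infinite
volume as `d ≥ 1`, so the integral would diverge. Unboundedness is what makes `Ψ⁻¹` finite and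
defined on all of `(0, ∞)`. -/
theorem CondA1.exists_lt_Phi (hd : 1 ≤ d) (hA : CondA1 ν M₀ tp) (C : ℝ) :
    ∃ ξ, C < Phi ν ξ := by
  by_contra! hC
  obtain ⟨t, ht, -, htp⟩ := hA.exists_pos_lt one_pos
  have : Nonempty (Fin d) := ⟨⟨0, hd⟩⟩
  have hbound := hA.bound t ht htp
  have hinf : volume (Metric.closedBall (0 : EuclideanSpace ℝ (Fin d)) 1)ᶜ = ⊤ := by
    rw [measure_compl Metric.isClosed_closedBall.measurableSet measure_closedBall_lt_top.ne,
      measure_univ_of_isAddLeftInvariant]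
    exact ENNReal.top_sub measure_closedBall_lt_top.ne
  have h1 : ∫⁻ ξ in (Metric.closedBall (0 : EuclideanSpace ℝ (Fin d)) 1)ᶜ,
      ENNReal.ofReal (Real.exp (-(t * C))) ≤
      ∫⁻ ξ : EuclideanSpace ℝ (Fin d), ENNReal.ofReal (Real.exp (-(t * Phi ν ξ)) * ‖ξ‖) := by
    refine le_trans (setLIntegral_mono_ae' Metric.isClosed_closedBall.measurableSet.compl
      (ae_of_all _ fun ξ hξ => ?_)) (setLIntegral_le_lintegral _ _)
    have hξ : 1 < ‖ξ‖ := by simpa using hξ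
    refine ENNReal.ofReal_le_ofReal ?_
    have : Real.exp (-(t * C)) ≤ Real.exp (-(t * Phi ν ξ)) :=
      Real.exp_le_exp.2 (neg_le_neg (mul_le_mul_of_nonneg_left (hC ξ) ht.le))
    nlinarith [Real.exp_pos (-(t * C))]
  rw [setLIntegral_const, hinf, ENNReal.mul_top (by simp [Real.exp_pos])] at h1
  exact absurd (h1.trans hbound) (by simp)

/-! ### The generalized inverse `Ψ⁻¹` and the scale `h` -/

section Inverse

variable (hc : Continuous (Phi ν)) (hu : ∀ C, ∃ ξ, C < Phi ν ξ)

include hc hu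

theorem exists_pos_Psi_gt (C : ℝ) : ∃ R : ℝ, 0 < R ∧ C < Psi ν R := by
  obtain ⟨ξ, hξ⟩ := hu C
  exact ⟨‖ξ‖ + 1, by positivity, hξ.trans_le (Phi_le_Psi hc (by linarith))⟩

/-- The supremum is attained: the level set is nonempty by the intermediate value theorem, bounded
because `Ψ` is monotone and unbounded, and closed by continuity. -/
theorem PsiInv_mem {s : ℝ} (hs : 0 < s) : 0 < PsiInv ν s ∧ Psi ν (PsiInv ν s) = s := by
  obtain ⟨R, hR, hRs⟩ := exists_pos_Psi_gt hc hu s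
  -- The condition `0 < r` may be relaxed to `0 ≤ r` because `Ψ(0) = 0 < s`; this is what makes the
  -- set closed.
  have hS : {r | 0 < r ∧ Psi ν r = s} = Set.Ici 0 ∩ Psi ν ⁻¹' {s} := by
    ext r
    simp only [Set.mem_ofPred_eq, Set.mem_inter_iff, Set.mem_Ici, Set.mem_preimage,
      Set.mem_singleton_iff]
    refine ⟨fun h => ⟨h.1.le, h.2⟩, fun h => ⟨lt_of_le_of_ne h.1 ?_, h.2⟩⟩
    rintro rfl
    exact hs.ne ((Psi_zero ν).symm.trans h.2)
  have hne : {r | 0 < r ∧ Psi ν r = s}.Nonempty := by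
    obtain ⟨r, hr, hrs⟩ := intermediate_value_Icc hR.le
      ((continuousOn_Psi hc).mono Set.Icc_subset_Ici_self)
      ⟨(Psi_zero ν).le.trans hs.le, hRs.le⟩
    rw [hS]
    exact ⟨r, hr.1, hrs⟩
  have hb : BddAbove {r | 0 < r ∧ Psi ν r = s} := by
    refine ⟨R, fun r hr => le_of_not_gt fun hlt => ?_⟩
    linarith [Psi_mono hc hR.le hlt.le, hr.2]
  have hcl : IsClosed {r | 0 < r ∧ Psi ν r = s} := by
    rw [hS]
    exact (continuousOn_Psi hc).preimage_isClosed_of_isClosed isClosed_Ici isClosed_singleton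
  exact hcl.csSup_mem hne hb

theorem PsiInv_lt {s r : ℝ} (hs : 0 < s) (hr : 0 < r) (hsr : s < Psi ν r) : PsiInv ν s < r := by
  by_contra! hle
  linarith [Psi_mono hc hr.le hle, (PsiInv_mem hc hu hs).2]

theorem PsiInv_mono {s s' : ℝ} (hs : 0 < s) (h : s ≤ s') : PsiInv ν s ≤ PsiInv ν s' := by
  rcases h.eq_or_lt with rfl | hlt
  · rfl
  · have h' := PsiInv_mem hc hu (hs.trans hlt)
    exact (PsiInv_lt hc hu hs h'.1 (by rwa [h'.2])).le

theorem h_pos {t : ℝ} (ht : 0 < t) : 0 < h ν t :=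
  one_div_pos.2 (PsiInv_mem hc hu (one_div_pos.2 ht)).1

theorem h_mono {t t' : ℝ} (ht : 0 < t) (htt : t ≤ t') : h ν t ≤ h ν t' :=
  one_div_le_one_div_of_le (PsiInv_mem hc hu (one_div_pos.2 (ht.trans_le htt))).1
    (PsiInv_mono hc hu (one_div_pos.2 (ht.trans_le htt)) (one_div_le_one_div_of_le ht htt))

theorem lt_h_of_lt_Psi {t r : ℝ} (ht : 0 < t) (hr : 0 < r) (htr : 1 / t < Psi ν r) :
    1 / r < h ν t :=
  one_div_lt_one_div_of_lt (PsiInv_mem hc hu (one_div_pos.2 ht)).1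
    (PsiInv_lt hc hu (one_div_pos.2 ht) hr htr)

theorem mul_Phi_le_one {t : ℝ} (ht : 0 < t) {ξ : EuclideanSpace ℝ (Fin d)}
    (hξ : ‖ξ‖ ≤ (h ν t)⁻¹) : t * Phi ν ξ ≤ 1 := by
  have h1 : Phi ν ξ ≤ 1 / t := by
    rw [← (PsiInv_mem hc hu (one_div_pos.2 ht)).2]
    refine Phi_le_Psi hc ?_
    rwa [h, one_div, inv_inv] at hξ
  calc t * Phi ν ξ ≤ t * (1 / t) := mul_le_mul_of_nonneg_left h1 ht.le
    _ = 1 := by field_simp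

theorem volume_real_closedBall_inv_h {t : ℝ} (ht : 0 < t) :
    volume.real (Metric.closedBall (0 : EuclideanSpace ℝ (Fin d)) (h ν t)⁻¹)
      = volume.real (Metric.ball (0 : EuclideanSpace ℝ (Fin d)) 1) * h ν t ^ (-(d : ℤ)) := by
  have hh := h_pos hc hu ht
  rw [Measure.real, Measure.addHaar_closedBall _ _ (inv_pos.2 hh).le, ENNReal.toReal_mul,
    ENNReal.toReal_ofReal (by positivity), mul_comm, finrank_euclideanSpace_fin, zpow_neg,
    zpow_natCast, inv_pow, Measure.real]

end Inverse

/-! ### Integral estimates from (A1) -/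

section Integrals

variable (hc : Continuous (Phi ν)) (hA : CondA1 ν M₀ tp)

include hc hA

theorem CondA1.integrable_mul_norm {t : ℝ} (ht : 0 < t) (htp : (t : EReal) < tp) :
    Integrable fun ξ => Real.exp (-(t * Phi ν ξ)) * ‖ξ‖ := by
  refine ⟨(by fun_prop : Continuous _).aestronglyMeasurable, ?_⟩
  rw [hasFiniteIntegral_iff_ofReal (ae_of_all _ fun ξ => by positivity)]
  exact (hA.bound t ht htp).trans_lt ENNReal.ofReal_lt_top

/-- Valid for every `t > 0`, also beyond `tp`: compare with some `t₀ ≤ t`, `t₀ < tp`, and use `1 <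
‖ξ‖` off the unit ball. -/
theorem CondA1.integrable_exp {t : ℝ} (ht : 0 < t) :
    Integrable fun ξ => Real.exp (-(t * Phi ν ξ)) := by
  obtain ⟨t₀, ht₀, htt, htp⟩ := hA.exists_pos_lt ht
  have h1 : Integrable fun ξ => (Metric.closedBall (0 : EuclideanSpace ℝ (Fin d)) 1).indicator
      (fun _ => (1 : ℝ)) ξ + Real.exp (-(t₀ * Phi ν ξ)) * ‖ξ‖ :=
    ((integrable_indicator_iff Metric.isClosed_closedBall.measurableSet).2
      (integrableOn_const measure_closedBall_lt_top.ne)).add (hA.integrable_mul_norm hc ht₀ htp)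
  refine h1.mono' (by fun_prop : Continuous _).aestronglyMeasurable (ae_of_all _ fun ξ => ?_)
  rw [Real.norm_of_nonneg (Real.exp_pos _).le]
  by_cases hξ : ξ ∈ Metric.closedBall (0 : EuclideanSpace ℝ (Fin d)) 1
  · rw [Set.indicator_of_mem hξ]
    have := exp_neg_mul_Phi_le_one (ν := ν) ht.le ξ
    have : 0 ≤ Real.exp (-(t₀ * Phi ν ξ)) * ‖ξ‖ := by positivity
    linarith
  · rw [Set.indicator_of_notMem hξ, zero_add]
    have hξ : 1 < ‖ξ‖ := by simpa using hξ
    have : Real.exp (-(t * Phi ν ξ)) ≤ Real.exp (-(t₀ * Phi ν ξ)) :=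
      Real.exp_le_exp.2 (neg_le_neg (mul_le_mul_of_nonneg_right htt (Phi_nonneg ν ξ)))
    nlinarith [Real.exp_pos (-(t₀ * Phi ν ξ))]

end Integrals

section Bounds

variable (hc : Continuous (Phi ν)) (hu : ∀ C, ∃ ξ, C < Phi ν ξ) (hA : CondA1 ν M₀ tp)

include hc hu hA

theorem CondA1.integral_mul_norm_le {t : ℝ} (ht : 0 < t) (htp : (t : EReal) < tp) :
    ∫ ξ, Real.exp (-(t * Phi ν ξ)) * ‖ξ‖ ≤ M₀ * h ν t ^ (-(d : ℤ)) * (h ν t)⁻¹ := by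
  have hh := h_pos hc hu ht
  rw [integral_eq_lintegral_of_nonneg_ae (ae_of_all _ fun ξ => by positivity)
    (by fun_prop : Continuous _).aestronglyMeasurable]
  refine ENNReal.toReal_le_of_le_ofReal (by have := hA.M₀_pos; positivity) ?_
  refine (hA.bound t ht htp).trans (ENNReal.ofReal_le_ofReal ?_)
  rw [zpow_sub_one₀ hh.ne', mul_assoc]

theorem CondA1.le_integral_exp {t : ℝ} (ht : 0 < t) :
    Real.exp (-1) * volume.real (Metric.ball (0 : EuclideanSpace ℝ (Fin d)) 1)
      * h ν t ^ (-(d : ℤ)) ≤ ∫ ξ, Real.exp (-(t * Phi ν ξ)) := by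
  rw [mul_assoc, ← volume_real_closedBall_inv_h hc hu ht, mul_comm]
  have hi := hA.integrable_exp hc ht
  calc volume.real (Metric.closedBall (0 : EuclideanSpace ℝ (Fin d)) (h ν t)⁻¹) * Real.exp (-1)
      = ∫ _ in Metric.closedBall (0 : EuclideanSpace ℝ (Fin d)) (h ν t)⁻¹, Real.exp (-1) := by
        rw [setIntegral_const, smul_eq_mul]
    _ ≤ ∫ ξ in Metric.closedBall (0 : EuclideanSpace ℝ (Fin d)) (h ν t)⁻¹,
          Real.exp (-(t * Phi ν ξ)) := by
        refine setIntegral_mono_on (integrableOn_const measure_closedBall_lt_top.ne)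
          hi.integrableOn Metric.isClosed_closedBall.measurableSet fun ξ hξ => ?_
        exact Real.exp_le_exp.2 (neg_le_neg (mul_Phi_le_one hc hu ht (by simpa using hξ)))
    _ ≤ _ := setIntegral_le_integral hi (ae_of_all _ fun ξ => (Real.exp_pos _).le)

/-- The integrand is at most `1` on the ball of radius `1/h(t)`; outside it `1 ≤ h(t)‖ξ‖`, so (A1)
controls the tail. -/
theorem CondA1.integral_exp_le {t : ℝ} (ht : 0 < t) (htp : (t : EReal) < tp) :
    ∫ ξ, Real.exp (-(t * Phi ν ξ)) ≤
      (volume.real (Metric.ball (0 : EuclideanSpace ℝ (Fin d)) 1) + M₀) * h ν t ^ (-(d : ℤ)) := by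
  have hh := h_pos hc hu ht
  have hb : MeasurableSet (Metric.closedBall (0 : EuclideanSpace ℝ (Fin d)) (h ν t)⁻¹) :=
    Metric.isClosed_closedBall.measurableSet
  have hi1 : Integrable ((Metric.closedBall (0 : EuclideanSpace ℝ (Fin d))
      (h ν t)⁻¹).indicator fun _ => (1 : ℝ)) :=
    (integrable_indicator_iff hb).2 (integrableOn_const measure_closedBall_lt_top.ne)
  have hi2 := (hA.integrable_mul_norm hc ht htp).const_mul (h ν t)
  calc ∫ ξ, Real.exp (-(t * Phi ν ξ))
      ≤ ∫ ξ, ((Metric.closedBall (0 : EuclideanSpace ℝ (Fin d)) (h ν t)⁻¹).indicator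
          (fun _ => (1 : ℝ)) ξ + h ν t * (Real.exp (-(t * Phi ν ξ)) * ‖ξ‖)) := by
        refine integral_mono (hA.integrable_exp hc ht) (hi1.add hi2) fun ξ => ?_
        have he := Real.exp_pos (-(t * Phi ν ξ))
        by_cases hξ : ξ ∈ Metric.closedBall (0 : EuclideanSpace ℝ (Fin d)) (h ν t)⁻¹
        · have h1 := exp_neg_mul_Phi_le_one (ν := ν) ht.le ξ
          have h2 : 0 ≤ h ν t * (Real.exp (-(t * Phi ν ξ)) * ‖ξ‖) := by positivity
          simp only [Set.indicator_of_mem hξ]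
          linarith
        · have hξ' : (h ν t)⁻¹ < ‖ξ‖ := by simpa using hξ
          have h1 : 1 ≤ h ν t * ‖ξ‖ := by
            rw [inv_lt_iff_one_lt_mul₀ hh] at hξ'
            linarith
          simp only [Set.indicator_of_notMem hξ]
          nlinarith
    _ = volume.real (Metric.closedBall (0 : EuclideanSpace ℝ (Fin d)) (h ν t)⁻¹)
          + h ν t * ∫ ξ, Real.exp (-(t * Phi ν ξ)) * ‖ξ‖ := by
        rw [integral_add hi1 hi2, integral_const_mul, integral_indicator hb]
        simp
    _ ≤ volume.real (Metric.closedBall (0 : EuclideanSpace ℝ (Fin d)) (h ν t)⁻¹)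
          + h ν t * (M₀ * h ν t ^ (-(d : ℤ)) * (h ν t)⁻¹) := by
        gcongr
        exact hA.integral_mul_norm_le hc hu ht htp
    _ = _ := by
        rw [volume_real_closedBall_inv_h hc hu ht]
        field_simp

end Bounds

/-! ### The transition density and its near-diagonal bounds -/

/-- The continuous transition density. -/
noncomputable def heatKernel (ν : Measure (EuclideanSpace ℝ (Fin d))) (t : ℝ) :
    EuclideanSpace ℝ (Fin d) → ℝ :=
  cosTransform fun ξ => Real.exp (-(t * Phi ν ξ))

theorem IsLevySemigroup.isContinuousDensity (hP : IsLevySemigroup ν P) (hA : CondA1 ν M₀ tp)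
    {t : ℝ} (ht : 0 < t) : IsContinuousDensity (P t) (heatKernel ν t) := by
  have := hP.isProbabilityMeasure t ht.le
  have hi := hA.integrable_exp hP.continuous_Phi ht
  exact ⟨continuous_cosTransform hi, cosTransform_nonneg hi (hP.charFun_eq t ht.le),
    eq_withDensity_cosTransform hi (hP.charFun_eq t ht.le)⟩

theorem IsLevySemigroup.conv_eq (hP : IsLevySemigroup ν P) {s t : ℝ} (hs : 0 ≤ s) (ht : 0 ≤ t) :
    P (s + t) = (P s).conv (P t) := by
  have := hP.isProbabilityMeasure s hs
  have := hP.isProbabilityMeasure t ht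
  have := hP.isProbabilityMeasure (s + t) (add_nonneg hs ht)
  refine Measure.ext_of_charFun (funext fun ξ => ?_)
  rw [charFun_conv, hP.charFun_eq s hs, hP.charFun_eq t ht, hP.charFun_eq _ (add_nonneg hs ht),
    ← Complex.ofReal_mul, ← Real.exp_add]
  congr 2
  ring

section HeatKernel

variable (hc : Continuous (Phi ν)) (hu : ∀ C, ∃ ξ, C < Phi ν ξ) (hA : CondA1 ν M₀ tp)

include hc hu hA

theorem CondA1.heatKernel_le {t : ℝ} (ht : 0 < t) (htp : (t : EReal) < tp)
    (x : EuclideanSpace ℝ (Fin d)) :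
    heatKernel ν t x ≤ ((2 * Real.pi) ^ d)⁻¹ *
      (volume.real (Metric.ball (0 : EuclideanSpace ℝ (Fin d)) 1) + M₀) * h ν t ^ (-(d : ℤ)) := by
  rw [heatKernel, cosTransform, finrank_euclideanSpace_fin, mul_assoc]
  refine mul_le_mul_of_nonneg_left (le_trans ?_ (hA.integral_exp_le hc hu ht htp)) (by positivity)
  have hi := hA.integrable_exp hc ht
  refine integral_mono (integrable_cos_mul hi x) hi fun ξ => ?_
  exact mul_le_of_le_one_left (Real.exp_pos _).le (Real.cos_le_one _)

/-- Since `1 - cos⟨ξ,x⟩ ≤ ‖ξ‖‖x‖`, the integral differs from its value at `x = 0` by at most `‖x‖`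
times the integral in (A1). The bound on `‖x‖` is chosen so that this loss is half of the lower
bound `CondA1.le_integral_exp`; the resulting constant is therefore free of `M₀`. -/
theorem CondA1.le_heatKernel {t : ℝ} (ht : 0 < t) (htp : (t : EReal) < tp)
    {x : EuclideanSpace ℝ (Fin d)}
    (hx : ‖x‖ ≤ Real.exp (-1) * volume.real (Metric.ball (0 : EuclideanSpace ℝ (Fin d)) 1)
      / (2 * M₀) * h ν t) :
    ((2 * Real.pi) ^ d)⁻¹ * (Real.exp (-1) *
      volume.real (Metric.ball (0 : EuclideanSpace ℝ (Fin d)) 1) / 2) * h ν t ^ (-(d : ℤ))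
      ≤ heatKernel ν t x := by
  have hh := h_pos hc hu ht
  have hM := hA.M₀_pos
  have hi := hA.integrable_exp hc ht
  have hi2 := hA.integrable_mul_norm hc ht htp
  rw [heatKernel, cosTransform, finrank_euclideanSpace_fin, mul_assoc]
  refine mul_le_mul_of_nonneg_left ?_ (by positivity)
  set ω := volume.real (Metric.ball (0 : EuclideanSpace ℝ (Fin d)) 1)
  have h1 : (∫ ξ, Real.exp (-(t * Phi ν ξ))) - ‖x‖ * ∫ ξ, Real.exp (-(t * Phi ν ξ)) * ‖ξ‖
      ≤ ∫ ξ, Real.cos (inner ℝ ξ x) * Real.exp (-(t * Phi ν ξ)) := by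
    rw [← integral_const_mul, ← integral_sub hi (hi2.const_mul _)]
    refine integral_mono (hi.sub (hi2.const_mul _)) (integrable_cos_mul hi x) fun ξ => ?_
    have he := Real.exp_pos (-(t * Phi ν ξ))
    have h2 : 1 - Real.cos (inner ℝ ξ x) ≤ ‖ξ‖ * ‖x‖ := by
      have h3 := Real.abs_cos_sub_cos_le (inner ℝ ξ x) 0
      have h4 := abs_real_inner_le_norm ξ x
      rw [Real.cos_zero, sub_zero] at h3
      linarith [neg_abs_le (Real.cos (inner ℝ ξ x) - 1)]
    dsimp only
    nlinarith
  have h2 : ‖x‖ * ∫ ξ, Real.exp (-(t * Phi ν ξ)) * ‖ξ‖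
      ≤ Real.exp (-1) * ω / (2 * M₀) * h ν t * (M₀ * h ν t ^ (-(d : ℤ)) * (h ν t)⁻¹) :=
    mul_le_mul hx (hA.integral_mul_norm_le hc hu ht htp)
      (integral_nonneg fun ξ => by positivity) (by positivity)
  have h3 : Real.exp (-1) * ω / (2 * M₀) * h ν t * (M₀ * h ν t ^ (-(d : ℤ)) * (h ν t)⁻¹)
      = Real.exp (-1) * ω / 2 * h ν t ^ (-(d : ℤ)) := by
    field_simp
  linarith [hA.le_integral_exp hc hu ht]

end HeatKernel

/-! ### Chaining through the semigroup -/

/-- A lower bound for the density of a convolution: if `f ≥ a` on a ball around `u` and `g ≥ b`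
on a sufficiently large ball around `0`, then the density of the convolution is at least
`a * b` times the volume of a ball in a neighbourhood of `u + v`. -/
theorem IsContinuousDensity.mul_le_of_conv {μ₁ μ₂ : Measure (EuclideanSpace ℝ (Fin d))}
    {f g k : EuclideanSpace ℝ (Fin d) → ℝ} (hf : IsContinuousDensity μ₁ f)
    (hg : IsContinuousDensity μ₂ g) (hk : IsContinuousDensity (μ₁.conv μ₂) k)
    {u v : EuclideanSpace ℝ (Fin d)} {a b r ρ : ℝ} (ha : 0 ≤ a) (hb : 0 ≤ b)
    (hv : ‖v‖ + 2 * ρ ≤ r) (hfa : ∀ y ∈ Metric.ball u ρ, a ≤ f y)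
    (hgb : ∀ y, ‖y‖ < r → b ≤ g y) {z : EuclideanSpace ℝ (Fin d)}
    (hz : z ∈ Metric.ball (u + v) ρ) :
    a * (b * volume.real (Metric.ball (0 : EuclideanSpace ℝ (Fin d)) ρ)) ≤ k z := by
  have hfm := hf.continuous.measurable.ennreal_ofReal
  have hgm := hg.continuous.measurable.ennreal_ofReal
  have h1 := hk.eq_withDensity
  rw [hf.eq_withDensity, hg.eq_withDensity, conv_withDensity_eq_lconvolution hfm hgm,
    withDensity_eq_iff_of_sigmaFinite (measurable_lconvolution volume hfm hgm).aemeasurable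
      hk.continuous.measurable.ennreal_ofReal.aemeasurable] at h1
  set c := a * (b * volume.real (Metric.ball (0 : EuclideanSpace ℝ (Fin d)) ρ)) with hc
  have h2 : ∀ᵐ w, w ∈ Metric.ball (u + v) ρ → c ≤ k w := by
    filter_upwards [h1] with w hw hwb
    refine (ENNReal.ofReal_le_ofReal_iff (hk.nonneg w)).1 ?_
    rw [← hw, lconvolution_def]
    calc ENNReal.ofReal c = ∫⁻ _ in Metric.ball u ρ, ENNReal.ofReal (a * b) := by
          rw [setLIntegral_const, Measure.addHaar_ball_center volume u ρ, hc, ← mul_assoc,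
            ENNReal.ofReal_mul (mul_nonneg ha hb), ofReal_measureReal]
      _ ≤ ∫⁻ y in Metric.ball u ρ, ENNReal.ofReal (f y) * ENNReal.ofReal (g (-y + w)) := by
          refine setLIntegral_mono_ae' measurableSet_ball (ae_of_all _ fun y hy => ?_)
          rw [ENNReal.ofReal_mul ha]
          refine mul_le_mul' (ENNReal.ofReal_le_ofReal (hfa y hy))
            (ENNReal.ofReal_le_ofReal (hgb _ ?_))
          rw [mem_ball_iff_norm] at hy hwb
          -- Both `y` and `w` may be off their centres `u` and `u + v` by `ρ`, hence the `2 * ρ` in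
          -- the hypothesis on `r`.
          have h3 : -y + w = (w - (u + v)) + v - (y - u) := by abel
          rw [h3]
          have h4 := norm_sub_le ((w - (u + v)) + v) (y - u)
          have h5 := norm_add_le (w - (u + v)) v
          linarith
      _ ≤ _ := setLIntegral_le_lintegral _ _
  -- The convolution formula gives the bound only almost everywhere. By continuity a failure at `z`
  -- would persist on a nonempty open set, which has positive measure.
  by_contra! hlt
  have hopen : IsOpen (Metric.ball (u + v) ρ ∩ k ⁻¹' Set.Iio c) :=
    Metric.isOpen_ball.inter (isOpen_Iio.preimage hk.continuous)
  have hpos := hopen.measure_pos volume ⟨z, hz, hlt⟩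
  refine hpos.ne' (measure_mono_null ?_ h2)
  rintro w ⟨hw1, hw2⟩ hw3
  exact absurd (hw3 hw1) (not_le.2 hw2)

/-- Iterating the local lower bound at time `τ` along the multiples of a vector `v`. -/
theorem IsLevySemigroup.le_density_add_one_smul (hP : IsLevySemigroup ν P)
    {p : ℝ → EuclideanSpace ℝ (Fin d) → ℝ}
    (hp : ∀ t : ℝ, 0 < t → IsContinuousDensity (P t) (p t)) {τ b r ρ : ℝ} (hτ : 0 < τ)
    (hb : 0 ≤ b) (hρ : 0 ≤ ρ) {v : EuclideanSpace ℝ (Fin d)} (hv : ‖v‖ + 2 * ρ ≤ r)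
    (hpb : ∀ y, ‖y‖ < r → b ≤ p τ y) (m : ℕ) :
    ∀ z ∈ Metric.ball (((m : ℝ) + 1) • v) ρ,
      b * (b * volume.real (Metric.ball (0 : EuclideanSpace ℝ (Fin d)) ρ)) ^ m
        ≤ p (((m : ℝ) + 1) * τ) z := by
  induction m with
  | zero =>
    intro z hz
    rw [mem_ball_iff_norm] at hz
    simp only [Nat.cast_zero, zero_add, one_smul, one_mul, pow_zero, mul_one] at hz ⊢
    refine hpb z ?_
    have := norm_add_le (z - v) v
    rw [sub_add_cancel] at this
    linarith
  | succ m ih =>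
    intro z hz
    have hm : 0 < ((m : ℝ) + 1) * τ := by positivity
    have h1 : (((m + 1 : ℕ) : ℝ) + 1) * τ = ((m : ℝ) + 1) * τ + τ := by push_cast; ring
    have h2 : (((m + 1 : ℕ) : ℝ) + 1) • v = ((m : ℝ) + 1) • v + v := by
      push_cast; rw [add_smul _ _ v, one_smul]
    rw [h1]
    rw [h2] at hz
    have hk := hp _ (add_pos hm hτ)
    rw [hP.conv_eq hm.le hτ.le] at hk
    rw [pow_succ, ← mul_assoc]
    exact (hp _ hm).mul_le_of_conv (hp τ hτ) hk (by positivity) hb hv ih hpb hz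

/-- If `m` steps of the time-scale `t / (m + 1)` suffice to reach `x`, the density at `x` is at
least geometric in `m`. -/
theorem IsLevySemigroup.le_density_of_steps (hP : IsLevySemigroup ν P)
    {p : ℝ → EuclideanSpace ℝ (Fin d) → ℝ}
    (hp : ∀ t : ℝ, 0 < t → IsContinuousDensity (P t) (p t)) {κ θ t : ℝ} (hκ : 0 < κ) (hθ : 0 < θ)
    (ht : 0 < t) (m : ℕ) (hh : 0 < h ν (t / (m + 1))) (hht : h ν (t / (m + 1)) ≤ h ν t)
    (hloc : ∀ y, ‖y‖ < θ * h ν (t / (m + 1)) →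
      κ * h ν (t / (m + 1)) ^ (-(d : ℤ)) ≤ p (t / (m + 1)) y)
    {x : EuclideanSpace ℝ (Fin d)} (hx : ‖x‖ / (m + 1) < θ * h ν (t / (m + 1)) / 2) :
    κ * h ν t ^ (-(d : ℤ)) * (κ * ((θ / 4) ^ d *
      volume.real (Metric.ball (0 : EuclideanSpace ℝ (Fin d)) 1))) ^ m ≤ p t x := by
  have hm : 0 < (m : ℝ) + 1 := by positivity
  set η := h ν (t / (m + 1)) with hη
  -- The step has length below `θη/2` and `2ρ = θη/2`, so the two together fit in the radius `θη` of
  -- the local bound.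
  have hρ : 0 < θ / 4 * η := by positivity
  have h1 := hP.le_density_add_one_smul hp (τ := t / (m + 1)) (b := κ * η ^ (-(d : ℤ)))
    (r := θ * η) (ρ := θ / 4 * η) (v := ((m : ℝ) + 1)⁻¹ • x) (by positivity) (by positivity) hρ.le
    (by
      rw [norm_smul, norm_inv, Real.norm_of_nonneg hm.le, inv_mul_eq_div]
      linarith) hloc m x
    (by rw [smul_smul, mul_inv_cancel₀ hm.ne', one_smul]; exact Metric.mem_ball_self hρ)
  rw [mul_div_cancel₀ _ hm.ne'] at h1
  -- Here the scale cancels: the gain per step depends on neither `t` nor the number of steps.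
  have h2 : κ * η ^ (-(d : ℤ)) * volume.real (Metric.ball (0 : EuclideanSpace ℝ (Fin d))
      (θ / 4 * η)) = κ * ((θ / 4) ^ d *
      volume.real (Metric.ball (0 : EuclideanSpace ℝ (Fin d)) 1)) := by
    rw [Measure.real, Measure.addHaar_ball_of_pos _ _ hρ, ENNReal.toReal_mul,
      ENNReal.toReal_ofReal (by positivity), finrank_euclideanSpace_fin, zpow_neg,
      zpow_natCast, Measure.real, mul_pow]
    field_simp
  rw [h2] at h1
  refine le_trans ?_ h1
  have h3 : h ν t ^ (-(d : ℤ)) ≤ η ^ (-(d : ℤ)) := by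
    rw [zpow_neg, zpow_neg, zpow_natCast, zpow_natCast]
    exact inv_anti₀ (by positivity) (pow_le_pow_left₀ hh.le hht d)
  gcongr

/-- A geometric lower bound is an exponential one. -/
theorem exp_neg_le_pow {q c a : ℝ} (hq : 0 < q) {m : ℕ} (hc : |Real.log q| ≤ c) (hm : (m : ℝ) ≤ a) :
    Real.exp (-(c * a)) ≤ q ^ m := by
  rw [← Real.exp_log hq, ← Real.exp_nat_mul, Real.exp_le_exp]
  have h1 : |Real.log q| * m ≤ c * a := mul_le_mul hc hm (by positivity) ((abs_nonneg _).trans hc)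
  have h2 : -(|Real.log q| * m) ≤ m * Real.log q := by
    rw [mul_comm, ← mul_neg]
    exact mul_le_mul_of_nonneg_left (neg_abs_le _) (by positivity)
  linarith

/-- The number of steps needed to reach `x` in time `t`: here `s` is such that `F s` is
the required speed, and `F` is only controlled by `Ψ(r) / r` for `r` in a set `S`. -/
theorem div_lt_h_of_speed (hc : Continuous (Phi ν)) (hu : ∀ C, ∃ ξ, C < Phi ν ξ) {F : ℝ → ℝ}
    {S : Set ℝ} (hF : StrictMonoOn F S) (hFΨ : ∀ r ∈ S, 0 < r → F r ≤ Psi ν r / r)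
    {η t s a : ℝ} (hη : 0 < η) (ht : 0 < t) (hs : s ∈ S) (ha : 0 < a)
    (hFs : F s = 2 * a / (η * t)) {n : ℝ} (hn : 0 < n) (hns : 2 * a * s / η < n)
    (hr : η * n / (2 * a) ∈ S) : a / n < η * h ν (t / n) / 2 := by
  have hr0 : 0 < η * n / (2 * a) := by positivity
  have hsr : s < η * n / (2 * a) := by
    rw [lt_div_iff₀ (by positivity)]
    rw [div_lt_iff₀ hη] at hns
    linarith
  have h1 := (hF hs hr hsr).trans_le (hFΨ _ hr hr0)
  rw [hFs, lt_div_iff₀ hr0] at h1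
  have h2 : 1 / (t / n) < Psi ν (η * n / (2 * a)) := by
    refine lt_of_eq_of_lt ?_ h1
    field_simp
  have h3 := lt_h_of_lt_Psi hc hu (div_pos ht hn) hr0 h2
  rw [one_div_div, div_lt_iff₀ (by positivity)] at h3
  rw [div_lt_iff₀ hn]
  linarith

end LevyHeat

/-! ### Choice of constants and number of steps -/

open LevyHeat in
theorem mainTheorem8 (d : ℕ) (hd : 1 ≤ d) :
    ∃ κ₁ : ℝ, 0 < κ₁ ∧ ∀ M₀ : ℝ, 0 < M₀ →
    ∃ κ₂ θ c₁ c₂ : ℝ, 0 < κ₂ ∧ 0 < θ ∧ 0 < c₁ ∧ 0 < c₂ ∧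
    ∀ (ν : Measure (EuclideanSpace ℝ (Fin d))) (tp : EReal)
      (P : ℝ → Measure (EuclideanSpace ℝ (Fin d))),
      LevyHeat.IsSymmInfLevyMeasure ν → LevyHeat.IsLevySemigroup ν P →
      LevyHeat.CondA1 ν M₀ tp →
    ∃ p : ℝ → EuclideanSpace ℝ (Fin d) → ℝ,
      -- `p t` is the transition density of `P t`
      (∀ t : ℝ, 0 < t → LevyHeat.IsContinuousDensity (P t) (p t)) ∧
      -- the near-diagonal estimate which specifies `θ`
      (∀ (t : ℝ) (x : EuclideanSpace ℝ (Fin d)), 0 < t → (t : EReal) < tp →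
        ‖x‖ < θ * LevyHeat.h ν t →
        κ₁ * LevyHeat.h ν t ^ (-(d : ℤ)) ≤ p t x ∧
          p t x ≤ κ₂ * LevyHeat.h ν t ^ (-(d : ℤ))) ∧
      -- the global case
      (∀ F : ℝ → ℝ, StrictMonoOn F (Set.Ici 0) → ContinuousOn F (Set.Ici 0) → F 0 = 0 →
        Tendsto F atTop atTop →
        (∀ s : ℝ, 0 < s → F s ≤ LevyHeat.Psi ν s / s) →
        ∀ η : ℝ, 0 < η → η < θ →
        ∀ (t : ℝ) (x : EuclideanSpace ℝ (Fin d)), 0 < t → (t : EReal) < tp →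
          c₁ * LevyHeat.h ν t ^ (-(d : ℤ)) *
            Real.exp (-(c₂ * ‖x‖ *
              Function.invFunOn F (Set.Ici 0) (2 * ‖x‖ / (η * t)) / η)) ≤ p t x) ∧
      -- the case of `F` defined on `[0, s₀]`
      (∀ (s₀ : ℝ) (F : ℝ → ℝ), 0 < s₀ →
        StrictMonoOn F (Set.Icc 0 s₀) → ContinuousOn F (Set.Icc 0 s₀) → F 0 = 0 →
        (∀ s : ℝ, 0 < s → s ≤ s₀ → F s ≤ LevyHeat.Psi ν s / s) →
        ∀ η : ℝ, 0 < η → η < θ →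
        ∀ (t : ℝ) (x : EuclideanSpace ℝ (Fin d)),
          1 / (s₀ * F (s₀ / 2)) < t → (t : EReal) < tp →
          ‖x‖ < η * t * F (s₀ / 2) / 2 →
          c₁ * LevyHeat.h ν t ^ (-(d : ℤ)) *
            Real.exp (-(c₂ * ‖x‖ *
              Function.invFunOn F (Set.Icc 0 s₀) (2 * ‖x‖ / (η * t)) / η)) ≤ p t x) := by
  have hω : 0 < volume.real (Metric.ball (0 : EuclideanSpace ℝ (Fin d)) 1) :=
    ENNReal.toReal_pos (Metric.measure_ball_pos _ _ one_pos).ne' measure_ball_lt_top.ne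
  set ω := volume.real (Metric.ball (0 : EuclideanSpace ℝ (Fin d)) 1) with hωdef
  set κ₁ := ((2 * Real.pi) ^ d)⁻¹ * (Real.exp (-1) * ω / 2) with hκ₁
  have hκ₁pos : 0 < κ₁ := by positivity
  refine ⟨κ₁, hκ₁pos, fun M₀ hM₀ => ?_⟩
  set θ := Real.exp (-1) * ω / (2 * M₀) with hθ
  have hθpos : 0 < θ := by positivity
  set q := κ₁ * ((θ / 4) ^ d * ω) with hq
  have hqpos : 0 < q := by positivity
  -- The factor `2` in `c₂` comes from the step count `2|x|s/η`; the `+ 1` keeps `c₂` positive even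
  -- if `q = 1`.
  refine ⟨((2 * Real.pi) ^ d)⁻¹ * (ω + M₀), θ, κ₁, 2 * (|Real.log q| + 1), by positivity, hθpos,
    hκ₁pos, by positivity, fun ν tp P _ hP hA => ?_⟩
  have hc := hP.continuous_Phi
  have hu := hA.exists_lt_Phi hd
  have hp := fun (t : ℝ) (ht : 0 < t) => hP.isContinuousDensity hA ht
  have hlow : ∀ (t : ℝ) (x : EuclideanSpace ℝ (Fin d)), 0 < t → (t : EReal) < tp →
      ‖x‖ < θ * h ν t → κ₁ * h ν t ^ (-(d : ℤ)) ≤ heatKernel ν t x :=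
    fun t x ht htp hx => hA.le_heatKernel hc hu ht htp hx.le
  have hchain : ∀ (η : ℝ), 0 < η → η < θ → ∀ (t : ℝ) (x : EuclideanSpace ℝ (Fin d)), 0 < t →
      (t : EReal) < tp → ∀ (s : ℝ) (m : ℕ), (m : ℝ) ≤ 2 * ‖x‖ * s / η →
      ‖x‖ / (m + 1) < η * h ν (t / (m + 1)) / 2 →
      κ₁ * h ν t ^ (-(d : ℤ)) * Real.exp (-(2 * (|Real.log q| + 1) * ‖x‖ * s / η))
        ≤ heatKernel ν t x := by
    intro η hη hηθ t x ht htp s m hm hx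
    have hm1 : (1 : ℝ) ≤ m + 1 := by simp
    have hτ : 0 < t / ((m : ℝ) + 1) := by positivity
    have hτt : t / ((m : ℝ) + 1) ≤ t := div_le_self ht.le hm1
    have hh := h_pos hc hu hτ
    have hτp : ((t / ((m : ℝ) + 1) : ℝ) : EReal) < tp :=
      lt_of_le_of_lt (EReal.coe_le_coe_iff.2 hτt) htp
    refine le_trans ?_ (hP.le_density_of_steps hp hκ₁pos hθpos ht m hh (h_mono hc hu hτ hτt)
      (fun y hy => hlow _ y hτ hτp hy) (hx.trans_le (by gcongr)))
    have hht := h_pos hc hu ht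
    refine mul_le_mul_of_nonneg_left ?_ (by positivity)
    refine le_trans (le_of_eq ?_) (exp_neg_le_pow hqpos (c := |Real.log q| + 1) (by linarith) hm)
    congr 1
    ring
  refine ⟨heatKernel ν, hp, fun t x ht htp hx => ⟨hlow t x ht htp hx,
    hA.heatKernel_le hc hu ht htp x⟩, ?_, ?_⟩
  · intro F hF hFc hF0 hFtop hFΨ η hη hηθ t x ht htp
    obtain ⟨hs, hFs⟩ : Function.invFunOn F (Set.Ici 0) (2 * ‖x‖ / (η * t)) ∈ Set.Ici 0 ∧
        F (Function.invFunOn F (Set.Ici 0) (2 * ‖x‖ / (η * t))) = 2 * ‖x‖ / (η * t) := by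
      refine Function.invFunOn_pos ?_
      have hy : 0 ≤ 2 * ‖x‖ / (η * t) := by positivity
      obtain ⟨R, hR, hR0⟩ :=
        ((hFtop.eventually_ge_atTop (2 * ‖x‖ / (η * t))).and (eventually_ge_atTop 0)).exists
      obtain ⟨r, hr, hrs⟩ := intermediate_value_Icc hR0 (hFc.mono Set.Icc_subset_Ici_self)
        ⟨hF0.le.trans hy, hR⟩
      exact ⟨r, hr.1, hrs⟩
    set s := Function.invFunOn F (Set.Ici 0) (2 * ‖x‖ / (η * t))
    have hs0 : 0 ≤ s := hs
    have ha : 0 ≤ 2 * ‖x‖ * s / η := by positivity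
    -- The floor `m` bounds the exponent from above, while the number of steps `m + 1` strictly
    -- exceeds `2|x|s/η`, as the speed argument requires.
    refine hchain η hη hηθ t x ht htp s ⌊2 * ‖x‖ * s / η⌋₊ (Nat.floor_le ha) ?_
    -- The origin is separate because the radius `ηn/(2|x|)` needs `x ≠ 0`.
    rcases (norm_nonneg x).eq_or_lt with hx | hx
    · rw [← hx, zero_div]
      have := h_pos hc hu (show 0 < t / ((⌊2 * 0 * s / η⌋₊ : ℝ) + 1) by positivity)
      positivity
    · exact div_lt_h_of_speed hc hu hF (fun r _ hr => hFΨ r hr) hη ht hs hx hFs (by positivity)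
        (Nat.lt_floor_add_one _) (show (0 : ℝ) ≤ _ by positivity)
  · intro s₀ F hs₀ hF hFc hF0 hFΨ η hη hηθ t x ht htp hxt
    have hmid : s₀ / 2 ∈ Set.Icc 0 s₀ := ⟨by positivity, by linarith⟩
    have hFpos : 0 < F (s₀ / 2) := by
      have := hF ⟨le_rfl, hs₀.le⟩ hmid (by positivity)
      rwa [hF0] at this
    have ht0 : 0 < t := lt_trans (by positivity) ht
    have hy : 2 * ‖x‖ / (η * t) < F (s₀ / 2) := by
      rw [div_lt_iff₀ (by positivity)]
      linarith
    obtain ⟨hs, hFs⟩ : Function.invFunOn F (Set.Icc 0 s₀) (2 * ‖x‖ / (η * t)) ∈ Set.Icc 0 s₀ ∧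
        F (Function.invFunOn F (Set.Icc 0 s₀) (2 * ‖x‖ / (η * t))) = 2 * ‖x‖ / (η * t) := by
      refine Function.invFunOn_pos ?_
      obtain ⟨r, hr, hrs⟩ := intermediate_value_Icc hmid.1
        (hFc.mono (Set.Icc_subset_Icc_right hmid.2)) ⟨hF0.le.trans (by positivity), hy.le⟩
      exact ⟨r, ⟨hr.1, hr.2.trans hmid.2⟩, hrs⟩
    set s := Function.invFunOn F (Set.Icc 0 s₀) (2 * ‖x‖ / (η * t))
    have hs0 : 0 ≤ s := hs.1
    have hs2 : s < s₀ / 2 := (hF.lt_iff_lt hs hmid).1 (hFs.trans_lt hy)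
    have ha : 0 ≤ 2 * ‖x‖ * s / η := by positivity
    refine hchain η hη hηθ t x ht0 htp s ⌊2 * ‖x‖ * s / η⌋₊ (Nat.floor_le ha) ?_
    rcases (norm_nonneg x).eq_or_lt with hx | hx
    · rw [← hx, zero_div]
      have := h_pos hc hu (show 0 < t / ((⌊2 * 0 * s / η⌋₊ : ℝ) + 1) by positivity)
      positivity
    -- The speed argument needs `F` at the radius `r = ηn/(2|x|)`, which may lie outside `[0, s₀]`.
    rcases le_or_gt (η * ((⌊2 * ‖x‖ * s / η⌋₊ : ℝ) + 1) / (2 * ‖x‖)) s₀ with hr | hr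
    · exact div_lt_h_of_speed hc hu hF (fun r hrS hr => hFΨ r hr hrS.2) hη ht0 hs hx hFs
        (by positivity) (Nat.lt_floor_add_one _) ⟨by positivity, hr⟩
    · have hfl := Nat.floor_le ha
      -- If `m ≥ 1`, then `m + 1 ≤ 2m` gives `r ≤ 2s < s₀`, a contradiction. This is why the
      -- hypotheses involve `s₀/2`.
      have hm : ⌊2 * ‖x‖ * s / η⌋₊ = 0 := by
        by_contra hne
        have h1 : (1 : ℝ) ≤ ⌊2 * ‖x‖ * s / η⌋₊ := by exact_mod_cast Nat.one_le_iff_ne_zero.2 hne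
        rw [lt_div_iff₀ (by positivity)] at hr
        rw [le_div_iff₀ hη] at hfl
        nlinarith
      rw [hm] at hr ⊢
      simp only [Nat.cast_zero, zero_add, mul_one, div_one] at hr ⊢
      -- With a single step, the lower bound on `t` replaces the speed argument: `1/t < s₀ F(s₀/2) <
      -- s₀ F(s₀) ≤ Ψ(s₀)`, so `h(t) > 1/s₀`, while `r > s₀` says `|x| < η/(2s₀)`.
      have h1 : 1 / t < Psi ν s₀ := by
        have h2 := (hF hmid ⟨hs₀.le, le_rfl⟩ (by linarith)).trans_le (hFΨ s₀ hs₀ le_rfl)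
        rw [lt_div_iff₀ hs₀] at h2
        rw [div_lt_iff₀ (by positivity)] at ht
        rw [div_lt_iff₀ ht0]
        nlinarith
      have h2 := lt_h_of_lt_Psi hc hu ht0 hs₀ h1
      rw [div_lt_iff₀ hs₀] at h2
      rw [lt_div_iff₀ (by positivity)] at hr
      nlinarith [h_pos hc hu ht0]
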